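/- Let $G$ be a compact (Hausdorff) Abelian group with Haar measure $\mu_G$ normalised so that $\mu_G(G)=1$, and let $\widehat G$ be the dual group of continuous homomorphisms $\gamma : G \to S^1=\{z\in\mathbb C : |z|=1\}$. For $f\in L^1(G)$ put $\widehat f(\gamma)=\int_G f(x)\overline{\gamma(x)}\,d\mu_G(x)$, and let $A(G)$ be the set of $f\in L^1(G)$ with $\sum_{\gamma\in\widehat G}|\widehat f(\gamma)|<\infty$. For a subgroup $V\le\widehat G$ let $V^\perp=\{x\in G : \gamma(x)=1 \text{ for all } \gamma\in V\}$, let $\mu_{V^\perp}$ be the Haar measure of the compact group $V^\perp$ with total mass $1$, regarded as a measure on $G$, and write $(f*\mu_{V^\perp})(x)=\int f(x-y)\,d\mu_{V^\perp}(y)$. Suppose that $A\subset G$ has characteristic function $\chi_A\in A(G)$. Then there is a finite subgroup $V\le\widehat G$ such that $\chi_A=\chi_A*\mu_{V^\perp}$ $\mu_G$-almost everywhere. Moreover $V^\perp$ is an open subgroup of $G$ of finite index, and $A$ coincides, up to a $\mu_G$-null set, with a union of cosets of $V^\perp$. -/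

import Mathlib

open MeasureTheory

noncomputable section

namespace CompactFourier

/-- The Fourier transform of `f : G → ℂ` (integrable, for it to be meaningful) with respect to
the normalised Haar measure `μ`: `γ ↦ ∫ f(x) conj(γ(x)) dμ(x)`, a function on the dual group of
continuous homomorphisms `G → S¹`. -/
def fourierTransform {G : Type*} [CommGroup G] [TopologicalSpace G] [MeasurableSpace G]
    (μ : Measure G) (f : G → ℂ) (γ : PontryaginDual G) : ℂ :=
  ∫ x, f x * (starRingEnd ℂ) ((γ x : Circle) : ℂ) ∂μ

/-- `f ∈ A(G)`: the function `f` lies in `L¹(G)` and its Fourier transform lies in `ℓ¹` of the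
dual group. -/
def MemA {G : Type*} [CommGroup G] [TopologicalSpace G] [MeasurableSpace G]
    (μ : Measure G) (f : G → ℂ) : Prop :=
  Integrable f μ ∧ Summable (fun γ : PontryaginDual G => ‖fourierTransform μ f γ‖)

/-- The annihilator `V^⊥ = {x ∈ G : γ(x) = 1 for all γ ∈ V}` of a subgroup `V` of the dual. -/
def annihilator {G : Type*} [CommGroup G] [TopologicalSpace G]
    (V : Subgroup (PontryaginDual G)) : Subgroup G where
  carrier := {x | ∀ γ ∈ V, γ x = 1}
  one_mem' := fun γ _ => map_one γ
  mul_mem' := fun {x y} hx hy γ hγ => by rw [map_mul, hx γ hγ, hy γ hγ, one_mul]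
  inv_mem' := fun {x} hx γ hγ => by rw [map_inv, hx γ hγ, inv_one]

theorem isClosed_annihilator {G : Type*} [CommGroup G] [TopologicalSpace G]
    (V : Subgroup (PontryaginDual G)) : IsClosed (annihilator V : Set G) := by
  have h : (annihilator V : Set G) = ⋂ γ ∈ V, {x | γ x = 1} := by
    ext x
    simp [annihilator]
  rw [h]
  exact isClosed_biInter fun γ _ => isClosed_eq (map_continuous γ) continuous_const

instance compactSpace_annihilator {G : Type*} [CommGroup G] [TopologicalSpace G] [CompactSpace G]
    (V : Subgroup (PontryaginDual G)) : CompactSpace (annihilator V) :=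
  isCompact_iff_compactSpace.mp (isClosed_annihilator V).isCompact

/-- The measure `μ_{V^⊥}` on `G`: the Haar measure of the compact group `V^⊥`, of total mass one,
regarded as a measure on `G` through the inclusion. -/
def annihilatorMeasure {G : Type*} [CommGroup G] [TopologicalSpace G] [IsTopologicalGroup G]
    [CompactSpace G] [MeasurableSpace G] [BorelSpace G]
    (V : Subgroup (PontryaginDual G)) : Measure G :=
  (Measure.haarMeasure (⊤ : TopologicalSpace.PositiveCompacts (annihilator V))).map
    (Subtype.val : annihilator V → G)

/-- The convolution of a function with a measure: `(f ∗ ν)(x) = ∫ f(x y⁻¹) dν(y)`. -/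
def convMeasure {G : Type*} [CommGroup G] [MeasurableSpace G]
    (f : G → ℂ) (ν : Measure G) (x : G) : ℂ :=
  ∫ y, f (x * y⁻¹) ∂ν

end CompactFourier

end

/-! The Fourier series of `χ_A` converges uniformly, so `χ_A` agrees a.e. with a continuous `g`,
whose only values are 0 and 1. Uniform continuity then makes the periods of `g` an open subgroup
`H`, of finite index by compactness. Take for `V` the finite group of characters trivial on `H`.
Translating by a period `a` multiplies the coefficient at `γ` by `γ a` yet leaves it unchanged, so
only `γ ∈ V` contribute to the series and `g` is invariant under `V^⊥`. The equality `V^⊥ = H` is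
not needed, only `H ≤ V^⊥`.

The analytic input is uniqueness of Fourier coefficients, `ae_eq_zero_of_fourierTransform_eq_zero`,
obtained from Gelfand theory. A nonzero square-integrable function acts nontrivially on `L²(G)`
through translations. The bicommutant of the translations is commutative, and one of its characters
does not kill this operator; restricted to the translations, it is a continuous character of `G`
with nonzero coefficient. -/

namespace CompactFourier

/-! ### Characters of a commutative bicommutant -/

/-- A nonzero element of the bicommutant of a commuting self-adjoint family in a C⋆-algebra is
detected by a contractive character of that bicommutant. -/
theorem exists_character_ne_zero {B : Type*} [CStarAlgebra B]
    {S : Set B} (hcomm : S ⊆ S.centralizer) (hstar : ∀ s ∈ S, star s ∈ S)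
    {T : B} (hT : T ∈ Subalgebra.centralizer ℂ S.centralizer) (hT0 : T ≠ 0) :
    ∃ φ : Subalgebra.centralizer ℂ S.centralizer →ₐ[ℂ] ℂ,
      (∀ a, ‖φ a‖ ≤ ‖a‖) ∧ φ ⟨T, hT⟩ ≠ 0 := by
  have : Nontrivial B := ⟨T, 0, hT0⟩
  let R := Subalgebra.centralizer ℂ S.centralizer
  -- The bicommutant lies in the commutant, hence is commutative.
  have hle : S.centralizer.centralizer ⊆ S.centralizer := Set.centralizer_subset hcomm
  let _ : NormedCommRing R :=
    { (inferInstance : NormedRing R) with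
      mul_comm := fun a b => Subtype.ext ((Set.mem_centralizer_iff.1 a.2 b (hle b.2)).symm) }
  let _ : NormedAlgebra ℂ R := inferInstance
  have : NormOneClass R := ⟨(CStarRing.norm_one : ‖(1 : B)‖ = 1)⟩
  have : CompleteSpace R := (Set.isClosed_centralizer (S.centralizer)).completeSpace_coe
  have hstarT : star T ∈ S.centralizer := by
    rw [Set.mem_centralizer_iff]
    intro s hs
    have := Set.mem_centralizer_iff.1 (hle hT) (star s) (hstar s hs)
    simpa using congrArg star this.symm
  have hnormal : IsStarNormal T := ⟨Set.mem_centralizer_iff.1 hT _ hstarT⟩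
  -- A normal element has spectral radius equal to its norm, here nonzero.
  obtain ⟨z, hz, hz0⟩ : ∃ z ∈ spectrum ℂ T, z ≠ 0 := by
    obtain ⟨z, hz, hzr⟩ := spectrum.exists_nnnorm_eq_spectralRadius T
    refine ⟨z, hz, fun h => hT0 ?_⟩
    rw [IsStarNormal.spectralRadius_eq_nnnorm, h] at hzr
    simpa using hzr.symm
  -- Passing to a subalgebra can only enlarge the spectrum.
  have hz' : z ∈ spectrum ℂ (⟨T, hT⟩ : R) :=
    AlgHom.spectrum_apply_subset R.val ⟨T, hT⟩ hz
  obtain ⟨f, hf⟩ := WeakDual.CharacterSpace.mem_spectrum_iff_exists.1 hz'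
  refine ⟨WeakDual.CharacterSpace.toAlgHom f, fun a => ?_, ?_⟩
  · exact AlgHom.norm_apply_le_self (WeakDual.CharacterSpace.toAlgHom f) a
  · simpa using hf ▸ hz0

/-! ### Integrated forms of unitary representations -/

section Operators

variable {G H : Type*} [TopologicalSpace G] [CompactSpace G]
  [MeasurableSpace G] [BorelSpace G] {μ : Measure G}
  [NormedAddCommGroup H] [InnerProductSpace ℂ H]

theorem integrable_smul_orbit (U : G → H →L[ℂ] H) (hbound : ∀ x v, ‖U x v‖ ≤ ‖v‖)
    (hcont : ∀ v, Continuous fun x => U x v) (f : Lp ℂ 1 μ) (v : H) :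
    Integrable (fun y => f y • U y v) μ := by
  have hf := L1.integrable_coeFn f
  refine (hf.norm.mul_const ‖v‖).mono'
    (hf.1.smul (hcont v).aestronglyMeasurable_of_compactSpace) (.of_forall fun y => ?_)
  rw [norm_smul]
  gcongr
  exact hbound y v

/-- The integrated form `f ↦ ∫ f(y) U(y) dμ(y)` of a strongly continuous family of contractions. -/
noncomputable def integratedForm (U : G → H →L[ℂ] H) (hbound : ∀ x v, ‖U x v‖ ≤ ‖v‖)
    (hcont : ∀ v, Continuous fun x => U x v) : Lp ℂ 1 μ →L[ℂ] H →L[ℂ] H :=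
  LinearMap.mkContinuous₂
    (LinearMap.mk₂ ℂ (fun (f : Lp ℂ 1 μ) (v : H) => ∫ y, f y • U y v ∂μ)
      (fun f g v => by
        rw [← integral_add (integrable_smul_orbit U hbound hcont f v)
          (integrable_smul_orbit U hbound hcont g v)]
        refine integral_congr_ae ?_
        filter_upwards [Lp.coeFn_add f g] with y hy
        rw [hy, Pi.add_apply, add_smul])
      (fun c f v => by
        rw [← integral_smul]
        refine integral_congr_ae ?_
        filter_upwards [Lp.coeFn_smul c f] with y hy
        rw [hy, Pi.smul_apply, smul_assoc])
      (fun f v w => by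
        rw [← integral_add (integrable_smul_orbit U hbound hcont f v)
          (integrable_smul_orbit U hbound hcont f w)]
        simp)
      (fun c f v => by
        rw [← integral_smul]
        simp [smul_comm c])) 1
    (fun f v => by
      rw [one_mul, LinearMap.mk₂_apply, L1.norm_eq_integral_norm, ← integral_mul_const]
      refine norm_integral_le_of_norm_le ((L1.integrable_coeFn f).norm.mul_const _)
        (.of_forall fun y => ?_)
      rw [norm_smul]
      gcongr
      exact hbound y v)

theorem integratedForm_apply (U : G → H →L[ℂ] H) (hbound : ∀ x v, ‖U x v‖ ≤ ‖v‖)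
    (hcont : ∀ v, Continuous fun x => U x v) (f : Lp ℂ 1 μ) (v : H) :
    integratedForm U hbound hcont f v = ∫ y, f y • U y v ∂μ := rfl

variable [CommGroup G] [IsTopologicalGroup G] [μ.IsHaarMeasure] [CompleteSpace H]

/-- If an integrable function acts nontrivially in some strongly continuous unitary representation
of a compact abelian group, then it has a nonvanishing Fourier coefficient. -/
theorem exists_integral_mul_character_ne_zero (U : G → H →L[ℂ] H)
    (hbound : ∀ x v, ‖U x v‖ ≤ ‖v‖) (hcont : ∀ v, Continuous fun x => U x v)
    (hone : U 1 = 1) (hmul : ∀ x y, U (x * y) = U x * U y) (hstar : ∀ x, star (U x) = U x⁻¹)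
    (f : Lp ℂ 1 μ) (hf : integratedForm U hbound hcont f ≠ 0) :
    ∃ γ : PontryaginDual G, ∫ x, f x * ((γ x : Circle) : ℂ) ∂μ ≠ 0 := by
  set T := integratedForm U hbound hcont f with hTdef
  let S : Set (H →L[ℂ] H) := Set.range U
  have hS : S ⊆ S.centralizer := by
    rintro _ ⟨x, rfl⟩
    rw [Set.mem_centralizer_iff]
    rintro _ ⟨y, rfl⟩
    rw [← hmul, ← hmul, mul_comm]
  have hSstar : ∀ s ∈ S, star s ∈ S := by
    rintro _ ⟨x, rfl⟩
    exact ⟨x⁻¹, (hstar x).symm⟩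
  have hU : ∀ x, U x ∈ Subalgebra.centralizer ℂ S.centralizer := fun x =>
    Set.subset_centralizer_centralizer ⟨x, rfl⟩
  have hT : T ∈ Subalgebra.centralizer ℂ S.centralizer := by
    refine Set.mem_centralizer_iff.2 fun R hR => ContinuousLinearMap.ext fun v => ?_
    change R (T v) = T (R v)
    rw [hTdef, integratedForm_apply, integratedForm_apply,
      ← ContinuousLinearMap.integral_comp_comm _ (integrable_smul_orbit U hbound hcont f v)]
    refine integral_congr_ae (.of_forall fun y => ?_)
    have : U y * R = R * U y := Set.mem_centralizer_iff.1 hR _ ⟨y, rfl⟩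
    simpa using congrArg (fun Q : H →L[ℂ] H => f y • Q v) this.symm
  obtain ⟨φ, hφ, hφT⟩ := exists_character_ne_zero hS hSstar hT hf
  let u : G → Subalgebra.centralizer ℂ S.centralizer := fun x => ⟨U x, hU x⟩
  let t : Subalgebra.centralizer ℂ S.centralizer := ⟨T, hT⟩
  have hu_mul : ∀ x y, u (x * y) = u x * u y := fun x y => Subtype.ext (hmul x y)
  have hu_one : u 1 = 1 := Subtype.ext hone
  have hφcont : Continuous φ :=
    AddMonoidHomClass.continuous_of_bound φ 1 fun a => by simpa using hφ a
  have htrans : ∀ x, U x * T =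
      integratedForm U hbound hcont (DomMulAct.mk x⁻¹ • f) := by
    intro x
    ext v
    change U x (T v) = _
    rw [hTdef, integratedForm_apply, integratedForm_apply,
      ← ContinuousLinearMap.integral_comp_comm _ (integrable_smul_orbit U hbound hcont f v),
      ← integral_mul_left_eq_self _ x⁻¹]
    refine integral_congr_ae ?_
    filter_upwards [DomMulAct.smul_Lp_ae_eq (DomMulAct.mk x⁻¹) f] with y hy
    rw [hy]
    simp [← mul_apply_eq_comp, ← hmul]
  -- `U` is only strongly continuous; multiplying by `T` gives norm continuity, because translation
  -- is continuous in `L¹`. Dividing by `φ t ≠ 0` then makes `φ ∘ u` continuous.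
  have hut_cont : Continuous fun x => u x * t := by
    refine Continuous.subtype_mk (f := fun x => U x * T) ?_ _
    simp_rw [htrans]
    refine (integratedForm U hbound hcont).continuous.comp ?_
    have : Fact ((1 : ENNReal) ≠ ⊤) := ⟨ENNReal.one_ne_top⟩
    have : Continuous fun x : G => DomMulAct.mk x⁻¹ :=
      DomMulAct.continuous_mk.comp continuous_inv
    exact this.smul continuous_const
  have hχcont : Continuous fun x => φ (u x) := by
    have h : (fun x => φ (u x)) = fun x => φ (u x * t) / φ t := by
      ext x
      rw [map_mul, mul_div_cancel_right₀ _ hφT]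
    rw [h]
    exact (hφcont.comp hut_cont).div_const _
  have hχle : ∀ x, ‖φ (u x)‖ ≤ 1 := fun x =>
    (hφ _).trans (ContinuousLinearMap.opNorm_le_bound _ zero_le_one fun v => by
      simpa using hbound x v)
  have hχinv : ∀ x, φ (u x) * φ (u x⁻¹) = 1 := fun x => by
    rw [← map_mul, ← hu_mul, mul_inv_cancel, hu_one, map_one]
  have hχnorm : ∀ x, ‖φ (u x)‖ = 1 := fun x => by
    refine le_antisymm (hχle x) ?_
    have h1 : ‖φ (u x)‖ * ‖φ (u x⁻¹)‖ = 1 := by rw [← norm_mul, hχinv, norm_one]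
    nlinarith [hχle x⁻¹, norm_nonneg (φ (u x)), norm_nonneg (φ (u x⁻¹))]
  let γ : G →ₜ* Circle :=
    { toFun := fun x => ⟨φ (u x), mem_sphere_zero_iff_norm.2 (hχnorm x)⟩
      map_one' := Subtype.ext (by simp [hu_one])
      map_mul' := fun x y => Subtype.ext ((congrArg φ (hu_mul x y)).trans (map_mul φ _ _))
      continuous_toFun := hχcont.subtype_mk _ }
  refine ⟨γ, fun h0 => hφT ?_⟩
  have hint : Integrable (fun y => f y • (u y * t)) μ := by
    refine ((L1.integrable_coeFn f).norm.mul_const ‖t‖).mono'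
      ((L1.integrable_coeFn f).1.smul hut_cont.aestronglyMeasurable_of_compactSpace)
      (.of_forall fun y => ?_)
    rw [norm_smul]
    gcongr
    refine ContinuousLinearMap.opNorm_le_bound _ (norm_nonneg _) fun v => ?_
    exact (hbound y (T v)).trans (T.le_opNorm v)
  have : CompleteSpace (Subalgebra.centralizer ℂ S.centralizer) :=
    (Set.isClosed_centralizer (S.centralizer)).completeSpace_coe
  -- The factor `t` makes the integrand norm-integrable, so that `φ` can be moved inside the
  -- integral.
  have hsq : t * t = ∫ y, f y • (u y * t) ∂μ := by
    ext v
    let ev : Subalgebra.centralizer ℂ S.centralizer →L[ℂ] H :=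
      (ContinuousLinearMap.apply ℂ H v).comp
        (Subalgebra.centralizer ℂ S.centralizer).toSubmodule.subtypeL
    change T (T v) = ev _
    rw [← ContinuousLinearMap.integral_comp_comm _ hint]
    rfl
  let φL : Subalgebra.centralizer ℂ S.centralizer →L[ℂ] ℂ := ⟨φ.toLinearMap, hφcont⟩
  have h2 : φ t * φ t = 0 := by
    rw [← map_mul, hsq]
    change φL _ = 0
    rw [← ContinuousLinearMap.integral_comp_comm _ hint]
    have : ∀ y, φL (f y • (u y * t)) = f y * ((γ y : Circle) : ℂ) * φ t := fun y => by
      change φ (f y • (u y * t)) = f y * φ (u y) * φ t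
      rw [map_smul, map_mul, smul_eq_mul, mul_assoc]
    simp_rw [this]
    rw [integral_mul_const]
    erw [h0]
    rw [zero_mul]
  exact mul_self_eq_zero.1 h2

end Operators

end CompactFourier

namespace CompactFourier

variable {G : Type*} [CommGroup G] [TopologicalSpace G] [IsTopologicalGroup G]
  [CompactSpace G] [MeasurableSpace G] [BorelSpace G]

/-! ### Uniqueness of Fourier coefficients via the regular representation -/

section Uniqueness

variable (μ : Measure G) [μ.IsHaarMeasure]

/-- The regular representation of `G` on `L²(G)`, `(x, v) ↦ v(x ·)`. -/
noncomputable def regularRep (x : G) : Lp ℂ 2 μ →L[ℂ] Lp ℂ 2 μ :=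
  LinearMap.mkContinuous
    { toFun := fun v => DomMulAct.mk x • v
      map_add' := fun v w => smul_add _ v w
      map_smul' := fun c v => smul_comm _ c v } 1
    fun v => by
      rw [one_mul]
      exact (DomMulAct.norm_smul_Lp (DomMulAct.mk x) v).le

omit [CompactSpace G] in
theorem regularRep_apply (x : G) (v : Lp ℂ 2 μ) : regularRep μ x v = DomMulAct.mk x • v := rfl

omit [CompactSpace G] in
theorem norm_regularRep_apply_le (x : G) (v : Lp ℂ 2 μ) : ‖regularRep μ x v‖ ≤ ‖v‖ :=
  (DomMulAct.norm_smul_Lp (DomMulAct.mk x) v).le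

theorem continuous_regularRep_apply (v : Lp ℂ 2 μ) : Continuous fun x => regularRep μ x v := by
  have : Fact ((2 : ENNReal) ≠ ⊤) := ⟨ENNReal.ofNat_ne_top⟩
  exact DomMulAct.continuous_mk.smul continuous_const

omit [CompactSpace G] in
theorem regularRep_one : regularRep μ (1 : G) = 1 := by
  ext1 v
  rw [regularRep_apply, DomMulAct.mk_one, one_smul, one_apply_eq_self]

omit [CompactSpace G] in
theorem regularRep_mul (x y : G) : regularRep μ (x * y) = regularRep μ x * regularRep μ y := by
  ext1 v
  rw [mul_apply_eq_comp, regularRep_apply, regularRep_apply, regularRep_apply, smul_smul,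
    ← DomMulAct.mk_mul, mul_comm]

omit [CompactSpace G] in
theorem star_regularRep (x : G) : star (regularRep μ x) = regularRep μ x⁻¹ := by
  rw [ContinuousLinearMap.star_eq_adjoint, eq_comm, ContinuousLinearMap.eq_adjoint_iff]
  intro v w
  rw [L2.inner_def, L2.inner_def, ← integral_mul_left_eq_self _ x]
  refine integral_congr_ae ?_
  have hq : Filter.Tendsto (fun y => x * y) (ae μ) (ae μ) :=
    (measurePreserving_mul_left μ x).quasiMeasurePreserving.tendsto_ae
  filter_upwards [hq.eventually (DomMulAct.smul_Lp_ae_eq (DomMulAct.mk x⁻¹) v),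
    DomMulAct.smul_Lp_ae_eq (DomMulAct.mk x) w] with y h1 h2
  rw [regularRep_apply, regularRep_apply, h1, h2]
  simp

/-- Translation `x ↦ v(x ·)` of a continuous function on `G`. -/
noncomputable def translate (v : C(G, ℂ)) : C(G, C(G, ℂ)) :=
  ContinuousMap.curry ⟨fun p : G × G => v (p.1 * p.2), by fun_prop⟩

omit [CompactSpace G] [MeasurableSpace G] [BorelSpace G] in
@[simp]
theorem translate_apply (v : C(G, ℂ)) (x y : G) : translate v x y = v (x * y) := rfl

theorem regularRep_toLp (v : C(G, ℂ)) (x : G) :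
    regularRep μ x (ContinuousMap.toLp 2 μ ℂ v) = ContinuousMap.toLp 2 μ ℂ (translate v x) := by
  rw [regularRep_apply]
  refine Lp.ext ?_
  have hq : Filter.Tendsto (fun y => x * y) (ae μ) (ae μ) :=
    (measurePreserving_mul_left μ x).quasiMeasurePreserving.tendsto_ae
  filter_upwards [DomMulAct.smul_Lp_ae_eq (DomMulAct.mk x) (ContinuousMap.toLp 2 μ ℂ v),
    hq.eventually (ContinuousMap.coeFn_toLp (p := 2) (𝕜 := ℂ) μ v),
    ContinuousMap.coeFn_toLp (p := 2) (𝕜 := ℂ) μ (translate v x)] with y h1 h2 h3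
  rw [h1, h3]
  simpa using h2

/-- An integrable function acting trivially in the regular representation annihilates all
continuous functions. -/
theorem integral_mul_eq_zero_of_integratedForm_eq_zero (f : Lp ℂ 1 μ)
    (hf : integratedForm (regularRep μ) (norm_regularRep_apply_le μ)
      (continuous_regularRep_apply μ) f = 0) (v : C(G, ℂ)) :
    ∫ x, f x * v x ∂μ = 0 := by
  have hint : Integrable (fun y => f y • translate v y) μ := by
    refine ((L1.integrable_coeFn f).norm.mul_const ‖v‖).mono'
      ((L1.integrable_coeFn f).1.smul
        (translate v).continuous.aestronglyMeasurable_of_compactSpace) (.of_forall fun y => ?_)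
    rw [norm_smul]
    gcongr
    exact (ContinuousMap.norm_le _ (norm_nonneg _)).2 fun z => v.norm_coe_le_norm _
  -- The vanishing is lifted from `L²` to `C(G, ℂ)`, where evaluation at `1` makes sense.
  have hzero : ∫ y, f y • translate v y ∂μ = 0 := by
    apply ContinuousMap.toLp_injective (p := 2) (𝕜 := ℂ) μ
    rw [map_zero, ← ContinuousLinearMap.integral_comp_comm _ hint]
    refine Eq.trans (b := integratedForm (regularRep μ) (norm_regularRep_apply_le μ)
      (continuous_regularRep_apply μ) f (ContinuousMap.toLp 2 μ ℂ v)) ?_ (by rw [hf]; rfl)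
    refine integral_congr_ae (.of_forall fun y => ?_)
    simp only [map_smul, regularRep_toLp]
  have := congrArg (ContinuousMap.evalCLM ℂ (1 : G)) hzero
  rw [← ContinuousLinearMap.integral_comp_comm _ hint] at this
  simpa using this

/-- Uniqueness of Fourier coefficients: a square-integrable function on a compact abelian group
all of whose Fourier coefficients vanish is zero almost everywhere. -/
theorem ae_eq_zero_of_fourierTransform_eq_zero {h : G → ℂ} (hh : MemLp h 2 μ)
    (hzero : ∀ γ, fourierTransform μ h γ = 0) : h =ᵐ[μ] 0 := by
  have hi : Integrable h μ := hh.integrable one_le_two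
  have hop : integratedForm (regularRep μ) (norm_regularRep_apply_le μ)
      (continuous_regularRep_apply μ) hi.toL1 = 0 := by
    by_contra hne
    obtain ⟨γ, hγ⟩ := exists_integral_mul_character_ne_zero (regularRep μ)
      (norm_regularRep_apply_le μ) (continuous_regularRep_apply μ) (regularRep_one μ)
      (regularRep_mul μ) (star_regularRep μ) hi.toL1 hne
    -- `γ⁻¹` offsets the conjugation in `fourierTransform`.
    refine hγ ((integral_congr_ae ?_).trans (hzero γ⁻¹))
    filter_upwards [hi.coeFn_toL1] with x hx
    rw [hx]
    change h x * _ = h x * (starRingEnd ℂ) (((γ x)⁻¹ : Circle) : ℂ)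
    rw [Circle.coe_inv_eq_conj, Complex.conj_conj]
  have horth : ∀ v : C(G, ℂ), ∫ x, h x * v x ∂μ = 0 := fun v => by
    rw [← integral_mul_eq_zero_of_integratedForm_eq_zero μ hi.toL1 hop v]
    refine integral_congr_ae ?_
    filter_upwards [hi.coeFn_toL1] with x hx
    rw [hx]
  have hL : hh.toLp h = 0 := by
    refine (ContinuousMap.toLp_denseRange ℂ μ ℂ (p := 2) (by simp)).eq_zero_of_inner_right ℂ fun v => ?_
    rw [L2.inner_def, ← horth (star v)]
    refine integral_congr_ae ?_
    filter_upwards [ContinuousMap.coeFn_toLp (p := 2) (𝕜 := ℂ) μ v, hh.coeFn_toLp] with x h1 h2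
    rw [h1, h2]
    simp
  exact hh.coeFn_toLp.symm.trans (hL ▸ Lp.coeFn_zero ℂ 2 μ)

end Uniqueness

end CompactFourier

namespace CompactFourier

variable {G : Type*} [CommGroup G] [TopologicalSpace G] [IsTopologicalGroup G]
  [CompactSpace G] [MeasurableSpace G] [BorelSpace G]

/-! ### Absolutely convergent Fourier series -/

section FourierSeries

/-- A character of `G` as a continuous complex-valued function. -/
noncomputable def characterMap (γ : PontryaginDual G) : C(G, ℂ) :=
  ⟨fun x => ((γ x : Circle) : ℂ), continuous_subtype_val.comp (map_continuous γ)⟩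

omit [IsTopologicalGroup G] [CompactSpace G] [MeasurableSpace G] [BorelSpace G] in
@[simp]
theorem characterMap_apply (γ : PontryaginDual G) (x : G) :
    characterMap γ x = ((γ x : Circle) : ℂ) := rfl

omit [IsTopologicalGroup G] [CompactSpace G] [MeasurableSpace G] [BorelSpace G] in
theorem norm_character (γ : PontryaginDual G) (x : G) : ‖((γ x : Circle) : ℂ)‖ = 1 :=
  Circle.norm_coe _

omit [IsTopologicalGroup G] [MeasurableSpace G] [BorelSpace G] in
theorem norm_characterMap_le (γ : PontryaginDual G) : ‖characterMap γ‖ ≤ 1 :=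
  (ContinuousMap.norm_le _ zero_le_one).2 fun x => (norm_character γ x).le

variable (μ : Measure G)

omit [CommGroup G] [IsTopologicalGroup G] in
theorem integrable_continuousMap [IsFiniteMeasure μ] (v : C(G, ℂ)) : Integrable v μ :=
  Integrable.of_bound v.continuous.aestronglyMeasurable_of_compactSpace ‖v‖
    (.of_forall v.norm_coe_le_norm)

omit [IsTopologicalGroup G] in
theorem integrable_mul_conj_character {f : G → ℂ} (hf : Integrable f μ) (γ : PontryaginDual G) :
    Integrable (fun x => f x * (starRingEnd ℂ) ((γ x : Circle) : ℂ)) μ :=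
  hf.mul_bdd (c := 1) (star (characterMap γ)).continuous.aestronglyMeasurable_of_compactSpace
    (.of_forall fun x => by simp [norm_character])

omit [IsTopologicalGroup G] in
theorem fourierTransform_sub {f g : G → ℂ} (hf : Integrable f μ) (hg : Integrable g μ)
    (γ : PontryaginDual G) :
    fourierTransform μ (f - g) γ = fourierTransform μ f γ - fourierTransform μ g γ := by
  unfold fourierTransform
  rw [← integral_sub (integrable_mul_conj_character μ hf γ) (integrable_mul_conj_character μ hg γ)]
  simp [sub_mul]

omit [IsTopologicalGroup G] [CompactSpace G] [BorelSpace G] in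
theorem fourierTransform_congr_ae {f g : G → ℂ} (h : f =ᵐ[μ] g) (γ : PontryaginDual G) :
    fourierTransform μ f γ = fourierTransform μ g γ :=
  integral_congr_ae (h.mono fun x hx => by simp only [hx])

/-- The Fourier coefficient at `γ`, as a continuous functional on `C(G, ℂ)`. -/
noncomputable def fourierCoeffCLM [IsProbabilityMeasure μ] (γ : PontryaginDual G) :
    C(G, ℂ) →L[ℂ] ℂ :=
  LinearMap.mkContinuous
    { toFun := fun v => fourierTransform μ v γ
      map_add' := fun v w => by
        unfold fourierTransform
        rw [← integral_add (integrable_mul_conj_character μ (integrable_continuousMap μ v) γ)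
          (integrable_mul_conj_character μ (integrable_continuousMap μ w) γ)]
        simp [add_mul]
      map_smul' := fun c v => by
        unfold fourierTransform
        rw [RingHom.id_apply, ← integral_smul]
        simp [mul_assoc] } 1
    fun v => by
      refine (norm_integral_le_of_norm_le_const (C := ‖v‖) (.of_forall fun x => ?_)).trans ?_
      · simpa [norm_character] using v.norm_coe_le_norm x
      · simp

omit [IsTopologicalGroup G] in
theorem fourierCoeffCLM_apply [IsProbabilityMeasure μ] (γ : PontryaginDual G) (v : C(G, ℂ)) :
    fourierCoeffCLM μ γ v = fourierTransform μ v γ := rfl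

variable [μ.IsHaarMeasure]

omit [CompactSpace G] in
/-- The behaviour of Fourier coefficients under translation. -/
theorem fourierTransform_translate (f : G → ℂ) (a : G) (γ : PontryaginDual G) :
    fourierTransform μ (fun x => f (a * x)) γ = ((γ a : Circle) : ℂ) * fourierTransform μ f γ := by
  unfold fourierTransform
  rw [← integral_const_mul, ← integral_mul_left_eq_self (fun x => _ * (f x * _)) a]
  refine integral_congr_ae (.of_forall fun x => ?_)
  have h : ((γ a : Circle) : ℂ) * (starRingEnd ℂ) ((γ a : Circle) : ℂ) = 1 := by
    rw [Complex.mul_conj, Complex.normSq_eq_norm_sq, norm_character]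
    simp
  simp only [map_mul, Circle.coe_mul]
  linear_combination -(f (a * x) * (starRingEnd ℂ) ((γ x : Circle) : ℂ)) * h

omit [IsTopologicalGroup G] [CompactSpace G] [BorelSpace G] [μ.IsHaarMeasure] in
theorem fourierTransform_characterMap_self [IsProbabilityMeasure μ] (γ : PontryaginDual G) :
    fourierTransform μ (characterMap γ) γ = 1 := by
  unfold fourierTransform
  simp [Complex.mul_conj, Complex.normSq_eq_norm_sq, norm_character]

omit [CompactSpace G] in
-- Translating by a point `a` where the characters differ multiplies the coefficient by both `γ a`
-- and `γ' a`, so it vanishes.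
theorem fourierTransform_characterMap_of_ne {γ γ' : PontryaginDual G} (h : γ ≠ γ') :
    fourierTransform μ (characterMap γ) γ' = 0 := by
  obtain ⟨a, ha⟩ : ∃ a, γ a ≠ γ' a := by
    by_contra! hall
    exact h (PontryaginDual.ext hall)
  have h1 := fourierTransform_translate μ (characterMap γ) a γ'
  have h2 : fourierTransform μ (fun x => characterMap γ (a * x)) γ' =
      ((γ a : Circle) : ℂ) * fourierTransform μ (characterMap γ) γ' := by
    unfold fourierTransform
    rw [← integral_const_mul]
    simp [mul_assoc]
  rw [h2] at h1
  by_contra h0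
  exact ha (Subtype.ext (mul_right_cancel₀ h0 h1))

/-- A bounded function in `A(G)` agrees almost everywhere with the sum of its Fourier series. -/
theorem MemA.exists_hasSum_ae_eq [IsProbabilityMeasure μ] {f : G → ℂ} (hf : MemA μ f)
    (hf2 : MemLp f 2 μ) :
    ∃ g : C(G, ℂ), HasSum (fun γ => fourierTransform μ f γ • characterMap γ) g ∧ f =ᵐ[μ] g := by
  have hs : Summable fun γ => fourierTransform μ f γ • characterMap γ := by
    refine Summable.of_norm_bounded hf.2 fun γ => ?_
    rw [norm_smul]
    exact mul_le_of_le_one_right (norm_nonneg _) (norm_characterMap_le γ)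
  obtain ⟨g, hg⟩ := hs
  refine ⟨g, hg, ?_⟩
  have hg2 : MemLp g 2 μ := MemLp.of_bound g.continuous.aestronglyMeasurable_of_compactSpace ‖g‖
    (.of_forall g.norm_coe_le_norm)
  have hcoeff : ∀ γ, fourierTransform μ g γ = fourierTransform μ f γ := fun γ => by
    have h1 := (fourierCoeffCLM μ γ).hasSum hg
    refine h1.unique ?_
    convert hasSum_single γ fun γ' hne => ?_ using 1
    · simp [fourierCoeffCLM_apply, fourierTransform_characterMap_self]
    · simp [fourierCoeffCLM_apply, fourierTransform_characterMap_of_ne μ hne]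
  have := ae_eq_zero_of_fourierTransform_eq_zero μ (hf2.sub hg2) fun γ => by
    rw [fourierTransform_sub μ hf.1 (integrable_continuousMap μ g), hcoeff, sub_self]
  filter_upwards [this] with x hx
  exact sub_eq_zero.1 hx

end FourierSeries

/-! ### Periods and annihilators -/

section Periods

/-- The group of periods of a continuous function on `G`. -/
def periods (g : C(G, ℂ)) : Subgroup G where
  carrier := {a | ∀ x, g (a * x) = g x}
  one_mem' := fun x => by rw [one_mul]
  mul_mem' := fun {a b} ha hb x => by rw [mul_assoc, ha, hb]
  inv_mem' := fun {a} ha x => by rw [← ha, mul_inv_cancel_left]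

omit [MeasurableSpace G] [BorelSpace G] in
-- Translation is continuous in the sup norm, and two `{0,1}`-valued functions at distance less than
-- 1 are equal.
theorem isOpen_periods {g : C(G, ℂ)} (hg : ∀ x, g x = 0 ∨ g x = 1) :
    IsOpen (periods g : Set G) := by
  have hopen : IsOpen {a | ‖translate g a - translate g 1‖ < 1} :=
    isOpen_lt (by fun_prop) continuous_const
  refine Subgroup.isOpen_of_mem_nhds _ (g := 1)
    (Filter.mem_of_superset (hopen.mem_nhds (by simp)) fun a ha x => ?_)
  have h : ‖g (a * x) - g x‖ < 1 := by
    simpa using ((translate g a - translate g 1).norm_coe_le_norm x).trans_lt ha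
  rcases hg (a * x) with h1 | h1 <;> rcases hg x with h2 | h2 <;> simp_all

/-- The characters that are trivial on a subgroup. -/
def dualAnnihilator (H : Subgroup G) : Subgroup (PontryaginDual G) where
  carrier := {γ | ∀ x ∈ H, γ x = 1}
  one_mem' := fun _ _ => rfl
  mul_mem' := fun {γ δ} hγ hδ x hx => by
    change γ x * δ x = 1
    rw [hγ x hx, hδ x hx, one_mul]
  inv_mem' := fun {γ} hγ x hx => by
    change (γ x)⁻¹ = 1
    rw [hγ x hx, inv_one]

omit [IsTopologicalGroup G] [CompactSpace G] [MeasurableSpace G] [BorelSpace G] in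
-- Such characters factor through the finite group `G ⧸ H`, which has finitely many homomorphisms to
-- `ℂˣ`.
theorem finite_dualAnnihilator (H : Subgroup G) [H.FiniteIndex] :
    Finite (dualAnnihilator H) := by
  have : Finite (G ⧸ H) := Subgroup.finite_quotient_of_finiteIndex
  let F : dualAnnihilator H → (G ⧸ H →* ℂˣ) := fun γ =>
    Circle.toUnits.comp (QuotientGroup.lift H (γ.1 : G →* Circle) fun x hx => γ.2 x hx)
  refine Finite.of_injective F fun γ δ h => Subtype.ext (PontryaginDual.ext fun x => ?_)
  have := congrArg (fun φ : G ⧸ H →* ℂˣ => ((φ x : ℂˣ) : ℂ)) h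
  exact Subtype.ext this

omit [IsTopologicalGroup G] [CompactSpace G] [MeasurableSpace G] [BorelSpace G] in
theorem le_annihilator_dualAnnihilator (H : Subgroup G) :
    H ≤ annihilator (dualAnnihilator H) := fun x hx _ hγ => hγ x hx

end Periods

/-- If `V^⊥` is open then its Haar measure is absolutely continuous with respect to that of `G`. -/
theorem annihilatorMeasure_absolutelyContinuous (μ : Measure G) [μ.IsHaarMeasure]
    {V : Subgroup (PontryaginDual G)} (hV : IsOpen (annihilator V : Set G)) :
    annihilatorMeasure V ≪ μ := by
  have hemb : Topology.IsOpenEmbedding (annihilator V).subtype := hV.isOpenEmbedding_subtypeVal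
  have : (μ.comap (annihilator V).subtype).IsHaarMeasure :=
    Measure.IsHaarMeasure.comap (mH := inferInstance) μ hemb
  have hac : Measure.haarMeasure (⊤ : TopologicalSpace.PositiveCompacts (annihilator V)) ≪
      μ.comap (annihilator V).subtype := by
    -- Haar measure on the compact group `V^⊥` is unique up to scaling.
    rw [Measure.isMulInvariant_eq_smul_of_compactSpace (Measure.haarMeasure ⊤)
      (μ.comap (annihilator V).subtype)]
    exact Measure.smul_absolutelyContinuous
  refine Measure.AbsolutelyContinuous.mk fun s hs h0 => ?_
  rw [annihilatorMeasure, Measure.map_apply measurable_subtype_coe hs]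
  refine hac ?_
  rw [hemb.measurableEmbedding.comap_apply]
  exact measure_mono_null (Set.image_preimage_subset _ _) h0

instance isProbabilityMeasure_annihilatorMeasure (V : Subgroup (PontryaginDual G)) :
    IsProbabilityMeasure (annihilatorMeasure V) := by
  have : IsProbabilityMeasure
      (Measure.haarMeasure (⊤ : TopologicalSpace.PositiveCompacts (annihilator V))) :=
    ⟨Measure.haarMeasure_self⟩
  exact Measure.isProbabilityMeasure_map measurable_subtype_coe.aemeasurable

theorem ae_mem_annihilator (V : Subgroup (PontryaginDual G)) :
    ∀ᵐ y ∂annihilatorMeasure V, y ∈ annihilator V := by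
  rw [annihilatorMeasure, ae_map_iff measurable_subtype_coe.aemeasurable (p := (· ∈ annihilator V))
    (isClosed_annihilator V).measurableSet]
  exact .of_forall fun y => y.2

end CompactFourier

/-! ### The structure of sets with characteristic function in `A(G)` -/

theorem proposition2p1 {G : Type*} [CommGroup G] [TopologicalSpace G] [IsTopologicalGroup G]
    [CompactSpace G] [T2Space G] [MeasurableSpace G] [BorelSpace G]
    (μ : MeasureTheory.Measure G) [μ.IsHaarMeasure] [MeasureTheory.IsProbabilityMeasure μ]
    (A : Set G) (hA : CompactFourier.MemA μ (A.indicator (fun _ => (1 : ℂ)))) :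
    ∃ V : Subgroup (PontryaginDual G), Finite V ∧
      A.indicator (fun _ => (1 : ℂ)) =ᵐ[μ]
        CompactFourier.convMeasure (A.indicator (fun _ => (1 : ℂ)))
          (CompactFourier.annihilatorMeasure V) ∧
      IsOpen (CompactFourier.annihilator V : Set G) ∧
      (CompactFourier.annihilator V).FiniteIndex ∧
      ∃ S : Set (G ⧸ CompactFourier.annihilator V),
        A =ᵐ[μ] (QuotientGroup.mk ⁻¹' S : Set G) := by
  open CompactFourier in
  set f : G → ℂ := A.indicator (fun _ => (1 : ℂ)) with hf
  have hf01 : ∀ x, f x = 0 ∨ f x = 1 := fun x => by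
    by_cases hx : x ∈ A <;> simp [hf, hx]
  have hf2 : MemLp f 2 μ := MemLp.of_bound hA.1.1 1 (.of_forall fun x => by
    rcases hf01 x with h | h <;> simp [h])
  obtain ⟨g, hsum, hfg⟩ := MemA.exists_hasSum_ae_eq μ hA hf2
  have hg01 : ∀ x, g x = 0 ∨ g x = 1 := fun x => by
    -- Haar measure charges nonempty open sets, so a continuous identity valid a.e. holds
    -- everywhere.
    have h : (fun x => g x * (g x - 1)) =ᵐ[μ] fun _ => 0 := by
      filter_upwards [hfg] with x hx
      rw [← hx]
      rcases hf01 x with h | h <;> simp [h]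
    have := congrFun ((Continuous.ae_eq_iff_eq μ (by fun_prop) continuous_const).1 h) x
    simpa [sub_eq_zero] using this
  let H := periods g
  have hHopen : IsOpen (H : Set G) := isOpen_periods hg01
  have : H.FiniteIndex := by
    have := H.quotient_finite_of_isOpen hHopen
    exact Subgroup.finiteIndex_of_finite_quotient
  let V := dualAnnihilator H
  have hsupp : ∀ γ, fourierTransform μ f γ ≠ 0 → γ ∈ V := fun γ hγ a ha => by
    rw [fourierTransform_congr_ae μ hfg] at hγ
    have h := fourierTransform_translate μ g a γ
    rw [funext (fun x => ha x : ∀ x, g (a * x) = g x)] at h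
    exact Subtype.ext (mul_right_cancel₀ hγ (by simpa using h.symm))
  have hinv : ∀ a ∈ annihilator V, ∀ x, g (x * a) = g x := fun a ha x => by
    have h1 := (ContinuousMap.evalCLM ℂ (x * a)).hasSum hsum
    have h2 := (ContinuousMap.evalCLM ℂ x).hasSum hsum
    refine h1.unique ((congrArg (HasSum · (g x)) (funext fun γ => ?_)).mp h2)
    by_cases hγ : fourierTransform μ f γ = 0
    · simp [hγ]
    · simp [ha γ (hsupp γ hγ)]
  have hle : H ≤ annihilator V := le_annihilator_dualAnnihilator H
  have hopen : IsOpen (annihilator V : Set G) := Subgroup.isOpen_mono hle hHopen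
  refine ⟨V, finite_dualAnnihilator H, ?_, hopen, Subgroup.finiteIndex_of_le hle,
    QuotientGroup.mk '' {x | g x = 1}, ?_⟩
  · filter_upwards [hfg] with x hx
    have hmp : MeasurePreserving (fun y => x * y⁻¹) μ μ :=
      (measurePreserving_mul_left μ x).comp (Measure.measurePreserving_inv μ)
    -- Since `f = g` only `μ`-a.e., absolute continuity is what carries the equality over to a coset
    -- of `V^⊥`.
    have hae : ∀ᵐ y ∂annihilatorMeasure V, f (x * y⁻¹) = g (x * y⁻¹) :=
      (annihilatorMeasure_absolutelyContinuous μ hopen).ae_le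
        (hmp.quasiMeasurePreserving.ae hfg)
    have hconst : (fun y => f (x * y⁻¹)) =ᵐ[annihilatorMeasure V] fun _ => g x := by
      filter_upwards [hae, ae_mem_annihilator V] with y h1 h2
      rw [h1, hinv _ (inv_mem h2)]
    rw [convMeasure, integral_congr_ae hconst, hx]
    simp
  · filter_upwards [hfg] with x hx
    refine propext ?_
    change x ∈ A ↔ ∃ y, g y = 1 ∧ (y : G ⧸ annihilator V) = x
    have hxA : x ∈ A ↔ g x = 1 := by
      rw [← hx]
      by_cases h : x ∈ A <;> simp [hf, h]
    rw [hxA]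
    refine ⟨fun h => ⟨x, h, rfl⟩, fun ⟨y, hy, hyx⟩ => ?_⟩
    rw [← hy, ← hinv _ (QuotientGroup.eq.1 hyx) y, mul_inv_cancel_left]
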